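/- Let $X$, $Y$, $\Theta$ be standard Borel spaces, let $(f_\theta)_{\theta\in\Theta}$ and $(g_\theta)_{\theta\in\Theta}$ be families of probability measures on $X$ and $Y$ respectively, measurable in $\theta$ (i.e. Markov kernels $f:\Theta\to X$ and $g:\Theta\to Y$), and let $m$ be a probability measure on $\Theta$. Let $P\Theta$ be the space of probability measures on $\Theta$, with the $\sigma$-algebra generated by the maps $p\mapsto p(S)$, $S\subseteq\Theta$ measurable. Let $f^\dagger : X\to\Theta$ be a Bayesian inverse of $f$ with respect to $m$, i.e. a Markov kernel with $$\int_S f_\theta(B)\,m(d\theta)=\int_B f^\dagger_x(S)\,(fm)(dx),\qquad fm:=\int_\Theta f_\theta\,m(d\theta),$$ for all measurable $S\subseteq\Theta$, $B\subseteq X$. The standard measure $\hat f_m$ of $f$ is the probability measure on $P\Theta$ that is the image of $fm$ under the measurable map $x\mapsto f^\dagger_x$; it does not depend on the choice of $f^\dagger$. The standard measure $\hat g_m$ is defined in the same way. For probability measures $p,q$ on $P\Theta$, say that $q$ second-order dominates $p$ if there is a $q$-dilation $t$ with $p=tq$, i.e. $p=\int_{P\Theta} t_\pi\,q(d\pi)$.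 Here a $q$-dilation is a Markov kernel $t:P\Theta\to P\Theta$ such that for $q$-almost all $\pi\in P\Theta$ the measure $t_\pi$ has barycenter $\pi$, i.e. $\int_{P\Theta}\rho(S)\,t_\pi(d\rho)=\pi(S)$ for all measurable $S\subseteq\Theta$. Then the following are equivalent: 1. There is a Markov kernel $c:X\to Y$ such that $g_\theta=c f_\theta$, i.e. $g_\theta(B)=\int_X c_x(B)\,f_\theta(dx)$ for all measurable $B\subseteq Y$, holds for $m$-almost all $\theta\in\Theta$. 2. The standard measure $\hat g_m$ second-order dominates the standard measure $\hat f_m$. No finiteness or countability of $\Theta$ is assumed. -/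

import Mathlib

open MeasureTheory ProbabilityTheory

section BlackwellShermanStein

variable {X Θ : Type*} [MeasurableSpace X] [MeasurableSpace Θ]

/-- The measurable map `k♯ : X → P A` associated with a Markov kernel `k` from `X` to `A`.
The space `P A = ProbabilityMeasure A` carries the σ-algebra generated by the evaluations
`p ↦ p S` for measurable `S`. -/
def kernelSharp {A : Type*} [MeasurableSpace A] (k : Kernel X A) [IsMarkovKernel k] (x : X) :
    ProbabilityMeasure A :=
  ⟨k x, inferInstance⟩

theorem measurable_kernelSharp {A : Type*} [MeasurableSpace A] (k : Kernel X A)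
    [IsMarkovKernel k] : Measurable (kernelSharp k) :=
  k.measurable.subtype_mk

/-- The posterior map `(f†)♯ : X → P Θ`, where `f†` is the Bayesian inverse of the experiment `f`
with respect to the prior `m`. -/
noncomputable def posteriorMap [StandardBorelSpace Θ] (f : Kernel Θ X) [IsMarkovKernel f]
    (m : Measure Θ) [IsProbabilityMeasure m] : X → ProbabilityMeasure Θ :=
  haveI : Nonempty Θ := nonempty_of_isProbabilityMeasure m
  kernelSharp (f†m)

theorem measurable_posteriorMap [StandardBorelSpace Θ] (f : Kernel Θ X) [IsMarkovKernel f]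
    (m : Measure Θ) [IsProbabilityMeasure m] : Measurable (posteriorMap f m) :=
  haveI : Nonempty Θ := nonempty_of_isProbabilityMeasure m
  measurable_kernelSharp (f†m)

/-- The standard experiment `f̂ = (f†)♯ ∘ f`, a Markov kernel from `Θ` to `P Θ`. -/
noncomputable def standardExperiment [StandardBorelSpace Θ] (f : Kernel Θ X) [IsMarkovKernel f]
    (m : Measure Θ) [IsProbabilityMeasure m] : Kernel Θ (ProbabilityMeasure Θ) :=
  Kernel.deterministic (posteriorMap f m) (measurable_posteriorMap f m) ∘ₖ f

/-- The standard measure `f̂_m = f̂ ∘ m`, a probability measure on `P Θ`. -/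
noncomputable def standardMeasure [StandardBorelSpace Θ] (f : Kernel Θ X) [IsMarkovKernel f]
    (m : Measure Θ) [IsProbabilityMeasure m] : Measure (ProbabilityMeasure Θ) :=
  standardExperiment f m ∘ₘ m

instance isMarkovKernel_standardExperiment [StandardBorelSpace Θ] (f : Kernel Θ X)
    [IsMarkovKernel f] (m : Measure Θ) [IsProbabilityMeasure m] :
    IsMarkovKernel (standardExperiment f m) := by
  unfold standardExperiment
  infer_instance

instance isProbabilityMeasure_standardMeasure [StandardBorelSpace Θ] (f : Kernel Θ X)
    [IsMarkovKernel f] (m : Measure Θ) [IsProbabilityMeasure m] :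
    IsProbabilityMeasure (standardMeasure f m) := by
  unfold standardMeasure
  infer_instance

/-- The barycenter `S ↦ ∫ p(S) ν(dp)` of a probability measure `ν` on `P Θ`; this is the structure
map `P P Θ → P Θ` of the free algebra `P Θ` of the distribution monad. -/
noncomputable def barycenter (ν : ProbabilityMeasure (ProbabilityMeasure Θ)) :
    ProbabilityMeasure Θ :=
  ⟨(ν : Measure (ProbabilityMeasure Θ)).bind (fun p => (p : Measure Θ)),
    isProbabilityMeasure_bind measurable_subtype_coe.aemeasurable
      (Filter.Eventually.of_forall fun p => p.2)⟩

/-- `t` is a `q`-dilation of `P Θ`: it sends `q`-almost every `p` to a distribution on `P Θ` with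
barycenter `p`. -/
def IsDilation (q : Measure (ProbabilityMeasure Θ))
    (t : Kernel (ProbabilityMeasure Θ) (ProbabilityMeasure Θ)) [IsMarkovKernel t] : Prop :=
  ∀ᵐ p ∂q, barycenter (kernelSharp t p) = p

/-- `q` second-order dominates `p`: some `q`-dilation converts `q` to `p`. -/
def SecondOrderDominates (q p : Measure (ProbabilityMeasure Θ)) : Prop :=
  ∃ (t : Kernel (ProbabilityMeasure Θ) (ProbabilityMeasure Θ)) (_ : IsMarkovKernel t),
    IsDilation q t ∧ p = t ∘ₘ q

end BlackwellShermanStein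

/-! Bayesian inversion reverses composition. Let `φf`, `φg` be the posterior maps of `f`, `g`. If `g
= c ∘ f` almost everywhere, then `g† = f† ∘ c†`: posteriors under `g` are averages of posteriors
under `f`. From `p`, draw `y` given `φg y = p`, then `x` from `c†`, and output `φf x`; this is the
dilation. Conversely, a dilation `t` gives a channel `h = t ∘ φg` from `Y` to `P Θ` that carries
`gm` to the standard measure of `f`. Its inverse guesses `y` from a posterior, and `c = h† ∘ φf` is
the garbling. Both directions rest on `lintegral_mul_posterior`, which moves test functions across
an inversion, and on `ae_eq_of_lintegral_indicator_mul_eq`. -/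

section BlackwellShermanStein

variable {X Y Θ : Type*} [MeasurableSpace X] [MeasurableSpace Y] [MeasurableSpace Θ]

/-- The tautological Markov kernel from `P Θ` to `Θ`, sending `p` to `p`. -/
noncomputable def tautologicalKernel (Θ : Type*) [MeasurableSpace Θ] :
    Kernel (ProbabilityMeasure Θ) Θ :=
  ⟨fun p => (p : Measure Θ), measurable_subtype_coe⟩

theorem tautologicalKernel_apply (p : ProbabilityMeasure Θ) :
    tautologicalKernel Θ p = (p : Measure Θ) := rfl

instance isMarkovKernel_tautologicalKernel : IsMarkovKernel (tautologicalKernel Θ) :=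
  ⟨fun p => p.2⟩

theorem coe_barycenter_kernelSharp (t : Kernel X (ProbabilityMeasure Θ)) [IsMarkovKernel t]
    (x : X) : (barycenter (kernelSharp t x) : Measure Θ) = (tautologicalKernel Θ ∘ₖ t) x := rfl

theorem coe_posteriorMap [StandardBorelSpace Θ] [Nonempty Θ] (f : Kernel Θ X) [IsMarkovKernel f]
    (m : Measure Θ) [IsProbabilityMeasure m] (x : X) :
    (posteriorMap f m x : Measure Θ) = (f†m) x := rfl

theorem standardMeasure_eq_map [StandardBorelSpace Θ] (f : Kernel Θ X) [IsMarkovKernel f]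
    (m : Measure Θ) [IsProbabilityMeasure m] :
    standardMeasure f m = (f ∘ₘ m).map (posteriorMap f m) := by
  rw [standardMeasure, standardExperiment, ← Measure.comp_assoc,
    Measure.deterministic_comp_eq_map]

/-- The defining property of the posterior, tested against products of functions. -/
theorem lintegral_mul_posterior [StandardBorelSpace Θ] [Nonempty Θ] (κ : Kernel Θ X)
    [IsFiniteKernel κ] (μ : Measure Θ) [IsFiniteMeasure μ] {u : X → ENNReal} {v : Θ → ENNReal}
    (hu : Measurable u) (hv : Measurable v) :
    ∫⁻ x, u x * ∫⁻ θ, v θ ∂(κ†μ) x ∂(κ ∘ₘ μ) = ∫⁻ θ, v θ * ∫⁻ x, u x ∂κ θ ∂μ := by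
  have h : ∫⁻ z, u z.1 * v z.2 ∂((κ ∘ₘ μ) ⊗ₘ κ†μ) = ∫⁻ z, v z.1 * u z.2 ∂(μ ⊗ₘ κ) := by
    rw [compProd_posterior_eq_map_swap, lintegral_map (by fun_prop) measurable_swap]
    simp only [Prod.fst_swap, Prod.snd_swap, mul_comm]
  rw [Measure.lintegral_compProd (by fun_prop), Measure.lintegral_compProd (by fun_prop)] at h
  simpa only [lintegral_const_mul _ hu, lintegral_const_mul _ hv] using h

/-- Finite kernels into a countably generated space agree almost everywhere if their integrals
agree over all measurable sets. -/
theorem ae_eq_of_lintegral_indicator_mul_eq [MeasurableSpace.CountablyGenerated Y]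
    {κ η : Kernel X Y} [IsFiniteKernel κ] [IsFiniteKernel η] {μ : Measure X} [IsFiniteMeasure μ]
    (h : ∀ (s : Set X) (t : Set Y), MeasurableSet s → MeasurableSet t →
      ∫⁻ x, s.indicator 1 x * κ x t ∂μ = ∫⁻ x, s.indicator 1 x * η x t ∂μ) :
    κ =ᵐ[μ] η := by
  have key (ζ : Kernel X Y) [IsFiniteKernel ζ] {s : Set X} {t : Set Y} (hs : MeasurableSet s)
      (ht : MeasurableSet t) : (μ ⊗ₘ ζ) (s ×ˢ t) = ∫⁻ x, s.indicator 1 x * ζ x t ∂μ := by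
    rw [Measure.compProd_apply_prod hs ht, ← lintegral_indicator hs]
    refine lintegral_congr fun x => ?_
    by_cases hx : x ∈ s <;> simp [hx]
  refine Kernel.ae_eq_of_compProd_eq (Measure.ext_prod fun {s t} hs ht => ?_)
  rw [key κ hs ht, key η hs ht, h s t hs ht]

theorem posterior_congr [StandardBorelSpace Θ] [Nonempty Θ] {κ η : Kernel Θ X}
    [IsFiniteKernel κ] [IsFiniteKernel η] {μ : Measure Θ} [IsFiniteMeasure μ]
    (h : κ =ᵐ[μ] η) : κ†μ = η†μ := by
  unfold posterior
  simp only [Measure.compProd_congr h]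

/-- A kernel `h` from `Y` to `Θ` that represents `φ : Y → P Θ` almost everywhere averages, over the
conditional distribution of `y` given `φ y = p`, to `p`. -/
theorem comp_posterior_deterministic_ae_eq_tautologicalKernel [StandardBorelSpace Y] [Nonempty Y]
    [MeasurableSpace.CountablyGenerated Θ] {φ : Y → ProbabilityMeasure Θ} (hφ : Measurable φ)
    (ν : Measure Y) [IsFiniteMeasure ν] (h : Kernel Y Θ) [IsFiniteKernel h]
    (hh : ∀ᵐ y ∂ν, h y = (φ y : Measure Θ)) :
    h ∘ₖ (Kernel.deterministic φ hφ)†ν =ᵐ[ν.map φ] tautologicalKernel Θ := by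
  refine ae_eq_of_lintegral_indicator_mul_eq fun B S hB hS => ?_
  have hu : Measurable (B.indicator (1 : ProbabilityMeasure Θ → ENNReal)) :=
    measurable_one.indicator hB
  rw [lintegral_map (f := fun p => B.indicator 1 p * tautologicalKernel Θ p S)
    (hu.mul ((tautologicalKernel Θ).measurable_coe hS)) hφ]
  simp only [Kernel.comp_apply' _ _ _ hS]
  -- Undoing the inversion leaves an integral over `ν`, where `h y` may be replaced by `φ y`.
  rw [← Measure.deterministic_comp_eq_map hφ, lintegral_mul_posterior _ _ hu (h.measurable_coe hS)]
  refine lintegral_congr_ae ?_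
  filter_upwards [hh] with y hy
  rw [Kernel.deterministic_apply, lintegral_dirac' _ hu, hy, mul_comm, tautologicalKernel_apply]

theorem secondOrderDominates_standardMeasure_of_garbling [StandardBorelSpace X]
    [StandardBorelSpace Y] [StandardBorelSpace Θ] (f : Kernel Θ X) [IsMarkovKernel f]
    (g : Kernel Θ Y) [IsMarkovKernel g] (m : Measure Θ) [IsProbabilityMeasure m]
    (c : Kernel X Y) [IsMarkovKernel c] (hc : ∀ᵐ θ ∂m, g θ = c ∘ₘ (f θ)) :
    SecondOrderDominates (standardMeasure g m) (standardMeasure f m) := by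
  have : Nonempty Θ := nonempty_of_isProbabilityMeasure m
  have : Nonempty X := nonempty_of_isProbabilityMeasure (f ∘ₘ m)
  have : Nonempty Y := nonempty_of_isProbabilityMeasure (g ∘ₘ m)
  have hgc : g =ᵐ[m] c ∘ₖ f := by
    filter_upwards [hc] with θ hθ
    rw [hθ, Kernel.comp_apply]
  have hgm : g ∘ₘ m = c ∘ₘ f ∘ₘ m := by
    rw [Measure.comp_assoc]
    exact Measure.comp_congr hgc
  let φf := Kernel.deterministic (posteriorMap f m) (measurable_posteriorMap f m)
  let φg := Kernel.deterministic (posteriorMap g m) (measurable_posteriorMap g m)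
  let t := φf ∘ₖ (c†(f ∘ₘ m) ∘ₖ φg†(g ∘ₘ m))
  have hf : f†m = tautologicalKernel Θ ∘ₖ φf := by
    rw [Kernel.comp_deterministic_eq_comap]
    rfl
  refine ⟨t, inferInstance, ?_, ?_⟩
  · have hpost : ∀ᵐ y ∂(g ∘ₘ m), (f†m ∘ₖ c†(f ∘ₘ m)) y = (posteriorMap g m y : Measure Θ) := by
      rw [hgm]
      filter_upwards [posterior_comp (κ := f) (μ := m) (η := c)] with y hy
      rw [← hy, ← posterior_congr hgc, coe_posteriorMap]
    have key := comp_posterior_deterministic_ae_eq_tautologicalKernel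
      (measurable_posteriorMap g m) (g ∘ₘ m) _ hpost
    rw [← standardMeasure_eq_map] at key
    filter_upwards [key] with p hp
    refine Subtype.ext ?_
    rw [hf, Kernel.comp_assoc, Kernel.comp_assoc] at hp
    exact (coe_barycenter_kernelSharp t p).trans hp
  · have hφg : standardMeasure g m = φg ∘ₘ g ∘ₘ m := by
      rw [standardMeasure_eq_map, Measure.deterministic_comp_eq_map]
    have hφf : standardMeasure f m = φf ∘ₘ f ∘ₘ m := by
      rw [standardMeasure_eq_map, Measure.deterministic_comp_eq_map]
    -- Each inverse carries the output marginal back to the input marginal: from the standard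
    -- measure of `g` to `gm`, then to `fm`, which `φf` pushes to the standard measure of `f`.
    simp only [t]
    rw [← Measure.comp_assoc, ← Measure.comp_assoc, hφg, posterior_comp_self, hgm,
      posterior_comp_self, hφf]

theorem exists_garbling_of_secondOrderDominates_standardMeasure [StandardBorelSpace Y]
    [StandardBorelSpace Θ] (f : Kernel Θ X) [IsMarkovKernel f]
    (g : Kernel Θ Y) [IsMarkovKernel g] (m : Measure Θ) [IsProbabilityMeasure m]
    (h : SecondOrderDominates (standardMeasure g m) (standardMeasure f m)) :
    ∃ c : Kernel X Y, IsMarkovKernel c ∧ ∀ᵐ θ ∂m, g θ = c ∘ₘ (f θ) := by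
  have : Nonempty Θ := nonempty_of_isProbabilityMeasure m
  have : Nonempty Y := nonempty_of_isProbabilityMeasure (g ∘ₘ m)
  obtain ⟨t, _, hdil, hft⟩ := h
  have hφf := measurable_posteriorMap f m
  have hφg := measurable_posteriorMap g m
  let h := t.comap (posteriorMap g m) hφg
  -- The null set of the dilation pulls back to a `gm`-null set, since the standard measure is the
  -- image of `gm`.
  have hbary : ∀ᵐ y ∂(g ∘ₘ m), ((tautologicalKernel Θ) ∘ₖ h) y = (g†m) y := by
    rw [IsDilation, standardMeasure_eq_map] at hdil
    filter_upwards [ae_of_ae_map hφg.aemeasurable hdil] with y hy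
    exact congrArg Subtype.val hy
  have hhm : (f ∘ₘ m).map (posteriorMap f m) = h ∘ₘ g ∘ₘ m := by
    rw [← standardMeasure_eq_map, hft, standardMeasure_eq_map,
      ← Measure.deterministic_comp_eq_map hφg, Measure.comp_assoc,
      Kernel.comp_deterministic_eq_comap]
  let c := (h†(g ∘ₘ m)).comap (posteriorMap f m) hφf
  refine ⟨c, inferInstance, ?_⟩
  suffices hcf : c ∘ₖ f =ᵐ[m] g by
    filter_upwards [hcf] with θ hθ
    rw [← hθ, Kernel.comp_apply]
  refine ae_eq_of_lintegral_indicator_mul_eq fun S B hS hB => ?_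
  have hS' : Measurable (S.indicator (1 : Θ → ENNReal)) := measurable_one.indicator hS
  have hB' : Measurable (B.indicator (1 : Y → ENNReal)) := measurable_one.indicator hB
  calc ∫⁻ θ, S.indicator 1 θ * (c ∘ₖ f) θ B ∂m
      = ∫⁻ θ, S.indicator 1 θ * ∫⁻ x, c x B ∂f θ ∂m := by
        simp only [Kernel.comp_apply' _ _ _ hB]
    _ = ∫⁻ x, c x B * (f†m) x S ∂(f ∘ₘ m) := by
        rw [← lintegral_mul_posterior f m (c.measurable_coe hB) hS']
        simp only [lintegral_indicator_one hS]
    _ = ∫⁻ q, (h†(g ∘ₘ m)) q B * tautologicalKernel Θ q S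
          ∂((f ∘ₘ m).map (posteriorMap f m)) := by
        -- Both factors depend on `x` only through its posterior.
        exact (lintegral_map (((h†(g ∘ₘ m)).measurable_coe hB).mul
          ((tautologicalKernel Θ).measurable_coe hS)) hφf).symm
    _ = ∫⁻ y, B.indicator 1 y * ((tautologicalKernel Θ) ∘ₖ h) y S ∂(g ∘ₘ m) := by
        simp only [Kernel.comp_apply' _ _ _ hS]
        -- By `hhm` the integral is over the output marginal of `h`, so `h†` can be undone.
        rw [hhm, ← lintegral_mul_posterior h (g ∘ₘ m)
          ((tautologicalKernel Θ).measurable_coe hS) hB']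
        simp only [lintegral_indicator_one hB, mul_comm]
    _ = ∫⁻ y, B.indicator 1 y * (g†m) y S ∂(g ∘ₘ m) := by
        refine lintegral_congr_ae ?_
        filter_upwards [hbary] with y hy
        rw [hy]
    _ = ∫⁻ θ, S.indicator 1 θ * g θ B ∂m := by
        simpa only [lintegral_indicator_one hB, lintegral_indicator_one hS]
          using lintegral_mul_posterior g m hB' hS'

end BlackwellShermanStein

theorem mainTheorem4 {X Y Θ : Type*}
    [MeasurableSpace X] [StandardBorelSpace X]
    [MeasurableSpace Y] [StandardBorelSpace Y]
    [MeasurableSpace Θ] [StandardBorelSpace Θ]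
    (f : Kernel Θ X) [IsMarkovKernel f]
    (g : Kernel Θ Y) [IsMarkovKernel g]
    (m : Measure Θ) [IsProbabilityMeasure m] :
    (∃ c : Kernel X Y, IsMarkovKernel c ∧ ∀ᵐ θ ∂m, g θ = c ∘ₘ (f θ)) ↔
      SecondOrderDominates (standardMeasure g m) (standardMeasure f m) :=
  ⟨fun ⟨c, _, hc⟩ => secondOrderDominates_standardMeasure_of_garbling f g m c hc,
    exists_garbling_of_secondOrderDominates_standardMeasure f g m⟩
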